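/- Let $\Pi$ be the set of all finite fractional power series $$\varphi(x,\xi)=\sum_{k=1}^{n_\varphi-1}a_k x^{1-k/m_\varphi}+\xi x^{1-n_\varphi/m_\varphi},\qquad a_k\in\mathbb{C},\quad m_\varphi,n_\varphi\in\mathbb{N}_{\ge 1},$$ written in lowest terms, i.e. the greatest common divisor of $m_\varphi$, $n_\varphi$ and all $k$ with $a_k\ne 0$ is $1$; here $\xi$ is a parameter. For $\psi,\varphi\in\Pi$ write $\psi\prec\varphi$ if $\varphi(x,\xi)=\psi(x,c+g(x,\xi))$ for some $c\in\mathbb{C}$ and some finite sum $g$ of terms $h(\xi)x^{r}$ with $h\in\mathbb{C}[\xi]$ and $r\in\mathbb{Q}$, $r<0$. Let $f=(P,Q)$ with $P,Q\in\mathbb{C}[x,y]$, $\deg_yP=\deg P$ and $\deg_yQ=\deg Q$, and let $J(P,Q)=P_xQ_y-P_yQ_x$. For $\varphi\in\Pi$ write $$P(x,\varphi(x,\xi))=p_\varphi(\xi)x^{a_\varphi/m_\varphi}+\cdots,\quad Q(x,\varphi(x,\xi))=q_\varphi(\xi)x^{b_\varphi/m_\varphi}+\cdots,\quad J(P,Q)(x,\varphi(x,\xi))=j_\varphi(\xi)x^{J_\varphi/m_\varphi}+\cdots,$$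 where the dots are terms of lower degree in $x$, the exponents $a_\varphi,b_\varphi,J_\varphi$ are integers and $p_\varphi,q_\varphi,j_\varphi\in\mathbb{C}[\xi]$ are nonzero (such a representation exists exactly when the polynomial in question is nonzero). The series $\varphi$ is a horizontal series of $P$ (of $Q$) if $a_\varphi=0$ and $\deg p_\varphi>0$ (resp. $b_\varphi=0$ and $\deg q_\varphi>0$); it is a dicritical series of $f$ if it is a horizontal series of $P$ or of $Q$ and $\max\{a_\varphi,b_\varphi\}=0$; it is a singular series of $f$ if $J(P,Q)\neq 0$ and $\deg j_\varphi>0$. **Theorem.** Let $\varphi\in\Pi$ be a dicritical series of $f$ with $a_\varphi=0$ and $b_\varphi<0$. Then $\varphi$ is a singular series of $f$, or there is a horizontal series $\psi\in\Pi$ of $Q$ such that $\psi$ is a singular series of $f$ and $\psi\prec\varphi$. -/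

import Mathlib

open scoped Polynomial

noncomputable section

namespace NewtonPuiseux

/-- Finite sums `∑ h_r(ξ) x ^ r` with rational exponents `r` and coefficients `h_r ∈ ℂ[ξ]`;
the polynomial variable of `ℂ[X]` is the parameter `ξ`. -/
abbrev FracSums : Type := AddMonoidAlgebra ℂ[X] ℚ

/-- The monomial `h(ξ) x ^ r`. -/
def mono (r : ℚ) (h : ℂ[X]) : FracSums := AddMonoidAlgebra.single r h

/-- `HasLeadingTerm F r h` says that `F = h(ξ) x ^ r + lower terms in x`, with `h ≠ 0`. -/
def HasLeadingTerm (F : FracSums) (r : ℚ) (h : ℂ[X]) : Prop :=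
  h ≠ 0 ∧ F.coeff r = h ∧ ∀ s, r < s → F.coeff s = 0

/-- The set `Π` of the finite fractional power series
`φ(x, ξ) = ∑_{k=1}^{n-1} a_k x ^ (1 - k/m) + ξ x ^ (1 - n/m)`, in lowest terms: no `d > 1`
divides `m`, `n` and all the `k` with `a_k ≠ 0`. Only the values `a k` with `1 ≤ k < n`
are used. -/
structure Series where
  /-- the common denominator `m_φ` of the exponents -/
  m : ℕ
  /-- the index `n_φ` of the exponent of the parameter term -/
  n : ℕ
  /-- the coefficients `a_k`, `1 ≤ k < n` -/
  a : ℕ → ℂ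
  m_pos : 0 < m
  n_pos : 0 < n
  lowest_terms : ∀ d : ℕ, d ∣ m → d ∣ n →
    (∀ k ∈ Finset.Ico 1 n, a k ≠ 0 → d ∣ k) → d = 1

namespace Series

/-- `φ(x, u)`: the parameter `ξ` of `φ` is replaced by the expression `u`. -/
def subst (φ : Series) (u : FracSums) : FracSums :=
  ∑ k ∈ Finset.Ico 1 φ.n, mono (1 - (k : ℚ) / φ.m) (Polynomial.C (φ.a k)) +
    u * mono (1 - (φ.n : ℚ) / φ.m) 1

/-- `φ(x, ξ)`. -/
def expr (φ : Series) : FracSums := φ.subst (mono 0 Polynomial.X)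

/-- `ψ ≺ φ`: `φ(x, ξ) = ψ(x, c + lower terms in x)` for some `c ∈ ℂ`. -/
def Prec (ψ φ : Series) : Prop :=
  ∃ (c : ℂ) (g : FracSums), (∀ r : ℚ, 0 ≤ r → g.coeff r = 0) ∧
    φ.expr = ψ.subst (mono 0 (Polynomial.C c) + g)

/-- `R(x, φ(x, ξ))` for a polynomial `R` in the variables `x` (index `0`) and `y`
(index `1`). -/
def along (φ : Series) (R : MvPolynomial (Fin 2) ℂ) : FracSums :=
  MvPolynomial.aeval ![mono 1 1, φ.expr] R

/-- `R(x, φ(x, ξ)) = h(ξ) x ^ (e / m_φ) + lower terms in x`, with `h ≠ 0`. For given `φ` and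
`R` there is at most one such pair `(e, h)`; for `R = P` it is `(a_φ, p_φ)`, for `R = Q` it is
`(b_φ, q_φ)`, and for `R = J(P, Q)` it is `(J_φ, j_φ)`. -/
def LeadsWith (φ : Series) (R : MvPolynomial (Fin 2) ℂ) (e : ℤ) (h : ℂ[X]) : Prop :=
  HasLeadingTerm (φ.along R) ((e : ℚ) / φ.m) h

/-- `φ` is a horizontal series of the polynomial `R`. -/
def IsHorizontal (φ : Series) (R : MvPolynomial (Fin 2) ℂ) : Prop :=
  ∃ h : ℂ[X], φ.LeadsWith R 0 h ∧ 0 < h.natDegree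

/-- `φ` is a dicritical series of the map `(P, Q)`. -/
def IsDicritical (φ : Series) (P Q : MvPolynomial (Fin 2) ℂ) : Prop :=
  (φ.IsHorizontal P ∨ φ.IsHorizontal Q) ∧
    ∃ (a b : ℤ) (p q : ℂ[X]), φ.LeadsWith P a p ∧ φ.LeadsWith Q b q ∧ max a b = 0

end Series

/-- The Jacobian determinant `J(P, Q) = P_x Q_y - P_y Q_x`. -/
def jacobian (P Q : MvPolynomial (Fin 2) ℂ) : MvPolynomial (Fin 2) ℂ :=
  MvPolynomial.pderiv 0 P * MvPolynomial.pderiv 1 Q -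
    MvPolynomial.pderiv 1 P * MvPolynomial.pderiv 0 Q

/-- `φ` is a singular series of the map `(P, Q)`: `deg j_φ > 0`. -/
def Series.IsSingular (φ : Series) (P Q : MvPolynomial (Fin 2) ℂ) : Prop :=
  ∃ (e : ℤ) (j : ℂ[X]), φ.LeadsWith (jacobian P Q) e j ∧ 0 < j.natDegree

/-- `R` is monic in `y` up to a constant factor: `deg_y R = deg R`. -/
def IsMonicInY (R : MvPolynomial (Fin 2) ℂ) : Prop :=
  R.degreeOf 1 = R.totalDegree

end NewtonPuiseux

end

/-!
For rational `t`, let `φ_t` consist of the terms of `φ` of exponent `> t`, followed by `ξ x ^ t`.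
The order in `x` of `Q(x, φ_t)` is negative when `t` is the exponent of the parameter term of `φ`,
and positive for `t = 1`, since `Q` is monic in `y`. It equals the order of `Q(x, φ(x, 0) + ξ x ^ t)`,
because the two expressions differ by a translation of `ξ` and terms of lower order; and the latter
is the maximum of `r + i τ` over the monomials `ξ ^ i x ^ r` of `Q(x, φ)`, where `τ` is the
difference of `t` and the parameter exponent. So the order vanishes at a rational `t < 1`
(`exists_shift_order_zero`, `Series.exists_subst_order_zero`), and `ψ = φ_t`, in lowest terms,
belongs to `Π` (`Series.exists_truncation`).

Write `φ(x, ξ) = ψ(x, c + lower terms)`. If the order of a polynomial `R` drops from `ψ` to `φ`, then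
`c` is a root of the leading coefficient of `R(x, ψ)`, which is therefore not constant. This applies
to `Q`. It also applies to `P`: if the order of `P` along `ψ` were `0` already, the leading
coefficient `p_φ` would be the constant `p_ψ(c)`, against the horizontality of `φ`. Hence `P` has a
positive order `α` along `ψ`.

By the chain rule, `J(P, Q)(x, ψ)` is, up to a power of `x`, the Jacobian of `P(x, ψ)` and `Q(x, ψ)`
with respect to `x` and `ξ` (`Series.along_jacobian`). Its leading coefficient is `α p_ψ q_ψ'`, which
is nonzero and nonconstant, so `ψ` is singular (`Series.isSingular_of_topCoeff`).
-/

open scoped Polynomial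

noncomputable section

namespace NewtonPuiseux

/-! ### Weak leading terms -/

/-- `F = h(ξ) x ^ r + lower terms in x`, where `h = 0` is allowed: no exponent of `F` exceeds `r`,
and the coefficient at `r` is `h`. Unlike `HasLeadingTerm` this is stable under sums and under
substitutions that may cancel the leading coefficient. -/
def TopCoeff (F : FracSums) (r : ℚ) (h : ℂ[X]) : Prop :=
  F.coeff r = h ∧ ∀ s, r < s → F.coeff s = 0

lemma HasLeadingTerm.topCoeff {F : FracSums} {r : ℚ} {h : ℂ[X]} (H : HasLeadingTerm F r h) :
    TopCoeff F r h := H.2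

lemma topCoeff_zero (r : ℚ) : TopCoeff 0 r 0 := by simp [TopCoeff]

lemma topCoeff_mono (r : ℚ) (h : ℂ[X]) : TopCoeff (mono r h) r h := by
  refine ⟨by simp [mono], fun s hs => ?_⟩
  simp [mono, hs.ne]

namespace TopCoeff

variable {F G : FracSums} {r s : ℚ} {f g : ℂ[X]}

lemma add (hF : TopCoeff F r f) (hG : TopCoeff G r g) : TopCoeff (F + G) r (f + g) := by
  refine ⟨by simp [hF.1, hG.1], fun t ht => by simp [hF.2 t ht, hG.2 t ht]⟩

lemma sub (hF : TopCoeff F r f) (hG : TopCoeff G r g) : TopCoeff (F - G) r (f - g) := by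
  refine ⟨by simp [hF.1, hG.1], fun t ht => by simp [hF.2 t ht, hG.2 t ht]⟩

lemma sum {ι : Type*} {A : Finset ι} {F : ι → FracSums} {f : ι → ℂ[X]}
    (h : ∀ i ∈ A, TopCoeff (F i) r (f i)) : TopCoeff (∑ i ∈ A, F i) r (∑ i ∈ A, f i) := by
  classical
  induction A using Finset.induction_on with
  | empty => simpa using topCoeff_zero r
  | insert i A hi ih =>
    rw [Finset.sum_insert hi, Finset.sum_insert hi]
    exact (h i (by simp)).add (ih fun j hj => h j (by simp [hj]))

lemma of_lt (hF : TopCoeff F r f) (h : r < s) : TopCoeff F s 0 :=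
  ⟨hF.2 s h, fun t ht => hF.2 t (h.trans ht)⟩

lemma mul (hF : TopCoeff F r f) (hG : TopCoeff G s g) : TopCoeff (F * G) (r + s) (f * g) := by
  have hle : ∀ a b, r + s ≤ a + b → F.coeff a ≠ 0 → G.coeff b ≠ 0 → a = r ∧ b = s := by
    intro a b hab ha hb
    have h1 : a ≤ r := not_lt.1 fun h => ha (hF.2 a h)
    have h2 : b ≤ s := not_lt.1 fun h => hb (hG.2 b h)
    constructor <;> linarith
  refine ⟨?_, fun t ht => ?_⟩
  · rw [← hF.1, ← hG.1]
    refine AddMonoidAlgebra.coeff_mul_add_of_uniqueAdd fun a b ha hb hab => ?_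
    exact hle a b hab.ge (by simpa using ha) (by simpa using hb)
  · rw [AddMonoidAlgebra.coeff_mul]
    refine Finset.sum_eq_zero fun a ha => Finset.sum_eq_zero fun b hb => if_neg ?_
    rintro rfl
    obtain ⟨rfl, rfl⟩ := hle a b ht.le (by simpa using ha) (by simpa using hb)
    exact lt_irrefl _ ht

lemma pow (hF : TopCoeff F r f) (n : ℕ) : TopCoeff (F ^ n) (n * r) (f ^ n) := by
  induction n with
  | zero => simpa [mono, AddMonoidAlgebra.one_def] using topCoeff_mono 0 1
  | succ n ih =>
    have := ih.mul hF
    rwa [← pow_succ, ← pow_succ, show (n : ℚ) * r + r = (n + 1 : ℕ) * r by push_cast; ring] at this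

lemma unique_coeff (hF : TopCoeff F r f) (hF' : TopCoeff F r g) : f = g := hF.1.symm.trans hF'.1

lemma hasLeadingTerm (hF : TopCoeff F r f) (hf : f ≠ 0) : HasLeadingTerm F r f := ⟨hf, hF⟩

/-- An exponent `r` that bounds those of `F` is at least the exponent of any nonzero term. -/
lemma le_of_coeff_ne (hF : TopCoeff F r f) (h : F.coeff s ≠ 0) : s ≤ r :=
  not_lt.1 fun hs => h (hF.2 s hs)

end TopCoeff

lemma exists_hasLeadingTerm {F : FracSums} (hF : F ≠ 0) : ∃ r h, HasLeadingTerm F r h := by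
  have hne : F.coeff.support.Nonempty := by
    rwa [Finsupp.support_nonempty_iff, ne_eq, AddMonoidAlgebra.coeff_eq_zero]
  refine ⟨F.coeff.support.max' hne, _, ?_, rfl, fun s hs => ?_⟩
  · simpa using Finset.max'_mem _ hne
  · by_contra h
    exact (Finset.le_max' F.coeff.support s (by simpa using h)).not_gt hs

lemma sum_mono_coeff (F : FracSums) : ∑ r ∈ F.coeff.support, mono r (F.coeff r) = F :=
  AddMonoidAlgebra.sum_coeff_single F

lemma mono_mul_mono (r s : ℚ) (f g : ℂ[X]) : mono r f * mono s g = mono (r + s) (f * g) :=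
  AddMonoidAlgebra.single_mul_single ..

lemma mono_zero_one : mono 0 1 = 1 := rfl

lemma coeff_mono (r s : ℚ) (h : ℂ[X]) : (mono r h).coeff s = if r = s then h else 0 := by
  simp [mono, Finsupp.single_apply]

/-! ### Substitution for the parameter -/

/-- The substitution `ξ ↦ u`, that is, `∑ h_r(ξ) x ^ r ↦ ∑ h_r(u) x ^ r`. -/
def substParam (u : FracSums) : FracSums →ₐ[ℂ] FracSums :=
  AddMonoidAlgebra.liftNCAlgHom (Polynomial.aeval u) (AddMonoidAlgebra.of ℂ[X] ℚ)
    fun _ _ => Commute.all _ _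

lemma substParam_mono (u : FracSums) (r : ℚ) (h : ℂ[X]) :
    substParam u (mono r h) = Polynomial.aeval u h * mono r 1 := by
  simp [substParam, mono, AddMonoidAlgebra.liftNC_single]

lemma algebraMap_eq_mono (c : ℂ) : algebraMap ℂ FracSums c = mono 0 (Polynomial.C c) := rfl

lemma substParam_mono_C (u : FracSums) (r : ℚ) (c : ℂ) :
    substParam u (mono r (Polynomial.C c)) = mono r (Polynomial.C c) := by
  rw [substParam_mono, Polynomial.aeval_C, algebraMap_eq_mono, mono_mul_mono, zero_add, mul_one]

lemma substParam_mono_X (u : FracSums) : substParam u (mono 0 Polynomial.X) = u := by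
  rw [substParam_mono, Polynomial.aeval_X, mono_zero_one, mul_one]

lemma topCoeff_aeval {u : FracSums} {v : ℂ[X]} (hu : TopCoeff u 0 v) (h : ℂ[X]) :
    TopCoeff (Polynomial.aeval u h) 0 (h.comp v) := by
  induction h using Polynomial.induction_on' with
  | add p q hp hq => simpa using hp.add hq
  | monomial n c =>
    have := (topCoeff_mono 0 (Polynomial.C c)).mul (hu.pow n)
    simpa [Polynomial.aeval_monomial, algebraMap_eq_mono] using this

/-- A substitution `ξ ↦ v(ξ) + lower terms in x` acts on the top coefficient by `ξ ↦ v(ξ)`. -/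
lemma TopCoeff.substParam {F u : FracSums} {r : ℚ} {f v : ℂ[X]} (hF : TopCoeff F r f)
    (hu : TopCoeff u 0 v) : TopCoeff (substParam u F) r (f.comp v) := by
  have hterm : ∀ s ∈ F.coeff.support, TopCoeff (NewtonPuiseux.substParam u (mono s (F.coeff s))) r
      (if s = r then f.comp v else 0) := by
    intro s hs
    have h := (topCoeff_aeval hu (F.coeff s)).mul (topCoeff_mono s 1)
    rw [← substParam_mono, zero_add, mul_one] at h
    split_ifs with hsr
    · subst hsr; rwa [hF.1] at h ⊢
    · exact h.of_lt (lt_of_le_of_ne (hF.le_of_coeff_ne (by simpa using hs)) hsr)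
  have := TopCoeff.sum hterm
  rw [← map_sum, sum_mono_coeff, Finset.sum_ite_eq'] at this
  split_ifs at this with hr
  · exact this
  · have hf : f = 0 := by rw [← hF.1]; simpa using hr
    simpa [hf] using this

/-- The substitution `ξ ↦ ξ x ^ τ` moves the monomial `ξ ^ i x ^ r` to `ξ ^ i x ^ (r + i τ)`. -/
lemma coeff_substParam_shift (τ : ℚ) (F : FracSums) (s : ℚ) (i : ℕ) :
    ((substParam (mono τ Polynomial.X) F).coeff s).coeff i = (F.coeff (s - i * τ)).coeff i := by
  suffices H : ∀ r h, ((substParam (mono τ Polynomial.X) (mono r h)).coeff s).coeff i =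
      ((mono r h).coeff (s - i * τ)).coeff i by
    conv_lhs => rw [← sum_mono_coeff F]
    conv_rhs => rw [← sum_mono_coeff F]
    simp only [map_sum, AddMonoidAlgebra.coeff_sum, Finsupp.finsetSum_apply,
      Polynomial.finsetSum_coeff, H]
  intro r h
  have hpow : ∀ n : ℕ, mono τ Polynomial.X ^ n = mono (n * τ) (Polynomial.X ^ n) := by
    intro n
    simp [mono, AddMonoidAlgebra.single_pow]
  rw [substParam_mono]
  induction h using Polynomial.induction_on' with
  | add p q hp hq =>
    have : mono r (p + q) = mono r p + mono r q := by simp [mono]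
    rw [this]
    simp only [map_add, add_mul, AddMonoidAlgebra.coeff_add, Finsupp.add_apply,
      Polynomial.coeff_add, hp, hq]
  | monomial n c =>
    rw [Polynomial.aeval_monomial, hpow, algebraMap_eq_mono, mono_mul_mono, mono_mul_mono,
      coeff_mono, coeff_mono, Polynomial.C_mul_X_pow_eq_monomial, mul_one]
    by_cases hn : n = i
    · subst hn
      congr 2
      simp only [eq_iff_iff]
      constructor <;> intro h <;> linarith
    · split_ifs <;> simp [Polynomial.coeff_monomial, hn]

/-! ### Derivations -/

/-- The linear map of `FracSums` that acts on the coefficient at the exponent `r` by `δ r`. -/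
def coeffMap (δ : ℚ → ℂ[X] →ₗ[ℂ] ℂ[X]) : FracSums →ₗ[ℂ] FracSums where
  toFun F := AddMonoidAlgebra.ofCoeff
    (Finsupp.onFinset F.coeff.support (fun r => δ r (F.coeff r)) fun r hr => by
      rw [Finsupp.mem_support_iff]
      intro h
      simp [h] at hr)
  map_add' F G := by ext1; ext1 r; simp
  map_smul' c F := by ext1; ext1 r; simp

lemma coeff_coeffMap (δ : ℚ → ℂ[X] →ₗ[ℂ] ℂ[X]) (F : FracSums) (r : ℚ) :
    (coeffMap δ F).coeff r = δ r (F.coeff r) := rfl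

lemma coeffMap_mono (δ : ℚ → ℂ[X] →ₗ[ℂ] ℂ[X]) (r : ℚ) (h : ℂ[X]) :
    coeffMap δ (mono r h) = mono r (δ r h) := by
  ext1; ext1 s
  rw [coeff_coeffMap, coeff_mono, coeff_mono]
  split_ifs with hrs <;> simp [*]

/-- The map `coeffMap δ` as a derivation, for a family `δ` that satisfies the Leibniz rule. -/
def coeffDerivation (δ : ℚ → ℂ[X] →ₗ[ℂ] ℂ[X])
    (hδ : ∀ r s f g, δ (r + s) (f * g) = f * δ s g + g * δ r f) :
    Derivation ℂ FracSums FracSums :=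
  Derivation.mk' (coeffMap δ) fun F G => by
    induction F using AddMonoidAlgebra.induction_linear with
    | zero => simp
    | add F₁ F₂ h₁ h₂ =>
      rw [add_mul, map_add, h₁, h₂, map_add]
      simp only [smul_eq_mul]; ring
    | single r f =>
      induction G using AddMonoidAlgebra.induction_linear with
      | zero => simp
      | add G₁ G₂ h₁ h₂ =>
        rw [mul_add, map_add, h₁, h₂, map_add]
        simp only [smul_eq_mul]; ring
      | single s g =>
        change coeffMap δ (mono r f * mono s g) =
          mono r f * coeffMap δ (mono s g) + mono s g * coeffMap δ (mono r f)
        rw [mono_mul_mono, coeffMap_mono, coeffMap_mono, coeffMap_mono, hδ, mono_mul_mono,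
          mono_mul_mono, add_comm s r]
        simp [mono]

/-- The partial derivative `∂/∂ξ`. -/
def derivParam : Derivation ℂ FracSums FracSums :=
  coeffDerivation (fun _ => Polynomial.derivative) fun _ _ f g => by
    simp [Polynomial.derivative_mul]; ring

/-- The Euler derivation `x ∂/∂x`, which multiplies the term of exponent `r` by `r`. -/
def eulerDeriv : Derivation ℂ FracSums FracSums :=
  coeffDerivation (fun r => (r : ℂ) • LinearMap.id) fun r s f g => by
    simp only [LinearMap.smul_apply, LinearMap.id_apply, Polynomial.smul_eq_C_mul, Rat.cast_add,
      map_add]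
    ring

lemma coeff_derivParam (F : FracSums) (r : ℚ) :
    (derivParam F).coeff r = Polynomial.derivative (F.coeff r) := rfl

lemma coeff_eulerDeriv (F : FracSums) (r : ℚ) :
    (eulerDeriv F).coeff r = Polynomial.C (r : ℂ) * F.coeff r := by
  rw [← Polynomial.smul_eq_C_mul]; rfl

lemma derivParam_mono (r : ℚ) (h : ℂ[X]) :
    derivParam (mono r h) = mono r (Polynomial.derivative h) := coeffMap_mono _ r h

lemma eulerDeriv_mono (r : ℚ) (h : ℂ[X]) :
    eulerDeriv (mono r h) = mono r (Polynomial.C (r : ℂ) * h) := by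
  rw [← Polynomial.smul_eq_C_mul]
  exact coeffMap_mono _ r h

lemma TopCoeff.derivParam {F : FracSums} {r : ℚ} {f : ℂ[X]} (hF : TopCoeff F r f) :
    TopCoeff (derivParam F) r (Polynomial.derivative f) :=
  ⟨by rw [coeff_derivParam, hF.1], fun s hs => by rw [coeff_derivParam, hF.2 s hs, map_zero]⟩

lemma TopCoeff.eulerDeriv {F : FracSums} {r : ℚ} {f : ℂ[X]} (hF : TopCoeff F r f) :
    TopCoeff (eulerDeriv F) r (Polynomial.C (r : ℂ) * f) :=
  ⟨by rw [coeff_eulerDeriv, hF.1], fun s hs => by rw [coeff_eulerDeriv, hF.2 s hs, mul_zero]⟩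

/-- The chain rule for a derivation applied to a polynomial expression. -/
lemma derivation_aeval {A : Type*} [CommRing A] [Algebra ℂ A] (D : Derivation ℂ A A)
    (v : Fin 2 → A) (R : MvPolynomial (Fin 2) ℂ) :
    D (MvPolynomial.aeval v R) = MvPolynomial.aeval v (MvPolynomial.pderiv 0 R) * D (v 0) +
      MvPolynomial.aeval v (MvPolynomial.pderiv 1 R) * D (v 1) := by
  induction R using MvPolynomial.induction_on with
  | C c => simp
  | add p q hp hq => simp only [map_add, hp, hq]; ring
  | mul_X p i hp =>
    simp only [map_mul, Derivation.leibniz, hp, MvPolynomial.aeval_X, smul_eq_mul, map_add,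
      MvPolynomial.pderiv_X]
    fin_cases i <;> simp <;> ring

/-! ### The expressions of a series -/

lemma substParam_aeval (u E : FracSums) (R : MvPolynomial (Fin 2) ℂ) :
    substParam u (MvPolynomial.aeval ![mono 1 1, E] R) =
      MvPolynomial.aeval ![mono 1 1, substParam u E] R := by
  rw [MvPolynomial.comp_aeval_apply]
  congr 2
  funext i
  fin_cases i
  · simpa using substParam_mono_C u 1 1
  · rfl

namespace Series

variable (φ : Series)

/-- The exponent `1 - n_φ / m_φ` of the parameter term of `φ`. -/
def paramExp : ℚ := 1 - (φ.n : ℚ) / φ.m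

/-- The part `∑ a_k x ^ (1 - k/m)` of `φ` without the parameter. -/
def head : FracSums :=
  ∑ k ∈ Finset.Ico 1 φ.n, mono (1 - (k : ℚ) / φ.m) (Polynomial.C (φ.a k))

lemma subst_eq (u : FracSums) : φ.subst u = φ.head + u * mono φ.paramExp 1 := rfl

lemma substParam_head (u : FracSums) : substParam u φ.head = φ.head := by
  simp only [head, map_sum, substParam_mono_C]

lemma substParam_subst (u v : FracSums) : substParam u (φ.subst v) = φ.subst (substParam u v) := by
  have h := substParam_mono_C u φ.paramExp 1
  rw [Polynomial.C_1] at h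
  rw [subst_eq, subst_eq, map_add, map_mul, substParam_head, h]

lemma substParam_expr (u : FracSums) : substParam u φ.expr = φ.subst u := by
  rw [expr, substParam_subst, substParam_mono_X]

lemma substParam_along (u : FracSums) (R : MvPolynomial (Fin 2) ℂ) :
    substParam u (φ.along R) = MvPolynomial.aeval ![mono 1 1, φ.subst u] R := by
  rw [along, substParam_aeval, substParam_expr]

lemma coeff_head (r : ℚ) : φ.head.coeff r =
    ∑ k ∈ Finset.Ico 1 φ.n, if 1 - (k : ℚ) / φ.m = r then Polynomial.C (φ.a k) else 0 := by
  simp only [head, AddMonoidAlgebra.coeff_sum, Finsupp.finsetSum_apply, coeff_mono]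

lemma coeff_head_eq_C (r : ℚ) : φ.head.coeff r = Polynomial.C ((φ.head.coeff r).coeff 0) := by
  refine Polynomial.eq_C_of_natDegree_eq_zero (Nat.le_zero.1 ?_)
  rw [coeff_head]
  refine Polynomial.natDegree_sum_le_of_forall_le _ _ fun k _ => ?_
  split_ifs <;> simp

lemma exists_of_coeff_head_ne {r : ℚ} (h : φ.head.coeff r ≠ 0) :
    ∃ k ∈ Finset.Ico 1 φ.n, r = 1 - (k : ℚ) / φ.m := by
  rw [coeff_head] at h
  obtain ⟨k, hk, hne⟩ := Finset.exists_ne_zero_of_sum_ne_zero h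
  exact ⟨k, hk, by by_contra h'; exact hne (if_neg fun h => h' h.symm)⟩

lemma lt_one_of_coeff_head_ne {r : ℚ} (h : φ.head.coeff r ≠ 0) : r < 1 := by
  obtain ⟨k, hk, rfl⟩ := φ.exists_of_coeff_head_ne h
  have hm : (0 : ℚ) < φ.m := by exact_mod_cast φ.m_pos
  have hk' : (0 : ℚ) < k := by exact_mod_cast (Finset.mem_Ico.1 hk).1
  have := div_pos hk' hm
  linarith

lemma topCoeff_head {t : ℚ} (ht : 1 ≤ t) : TopCoeff φ.head t 0 := by
  refine ⟨?_, fun s hs => ?_⟩ <;> by_contra h <;> have := φ.lt_one_of_coeff_head_ne h <;> linarith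

/-- All exponents along `φ` are integer multiples of `1 / m_φ`. -/
lemma exists_int_of_coeff_along_ne (R : MvPolynomial (Fin 2) ℂ) :
    ∀ r, (φ.along R).coeff r ≠ 0 → ∃ e : ℤ, r = (e : ℚ) / φ.m := by
  have hm : (φ.m : ℚ) ≠ 0 := by exact_mod_cast φ.m_pos.ne'
  have hmono : ∀ (e : ℤ) (s : ℚ) (h : ℂ[X]), s = (e : ℚ) / φ.m → ∀ r, (mono s h).coeff r ≠ 0 →
      ∃ e : ℤ, r = (e : ℚ) / φ.m := by
    rintro e s h hs r hr
    rw [coeff_mono] at hr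
    split_ifs at hr with h'
    · exact ⟨e, h' ▸ hs⟩
    · exact absurd rfl hr
  have hadd : ∀ F G : FracSums, (∀ r, F.coeff r ≠ 0 → ∃ e : ℤ, r = (e : ℚ) / φ.m) →
      (∀ r, G.coeff r ≠ 0 → ∃ e : ℤ, r = (e : ℚ) / φ.m) →
      ∀ r, (F + G).coeff r ≠ 0 → ∃ e : ℤ, r = (e : ℚ) / φ.m := by
    intro F G hF hG r hr
    by_cases h : F.coeff r = 0
    · exact hG r (by simpa [h] using hr)
    · exact hF r h
  have hmul : ∀ F G : FracSums, (∀ r, F.coeff r ≠ 0 → ∃ e : ℤ, r = (e : ℚ) / φ.m) →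
      (∀ r, G.coeff r ≠ 0 → ∃ e : ℤ, r = (e : ℚ) / φ.m) →
      ∀ r, (F * G).coeff r ≠ 0 → ∃ e : ℤ, r = (e : ℚ) / φ.m := by
    intro F G hF hG r hr
    have hr' := AddMonoidAlgebra.support_coeff_mul_subset F G (Finsupp.mem_support_iff.2 hr)
    obtain ⟨a, ha, b, hb, rfl⟩ := Finset.mem_add.1 hr'
    obtain ⟨e, rfl⟩ := hF a (Finsupp.mem_support_iff.1 ha)
    obtain ⟨e', rfl⟩ := hG b (Finsupp.mem_support_iff.1 hb)
    exact ⟨e + e', by push_cast; ring⟩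
  have hexpr : ∀ r, φ.expr.coeff r ≠ 0 → ∃ e : ℤ, r = (e : ℚ) / φ.m := by
    rw [expr, subst_eq, mono_mul_mono]
    refine hadd _ _ (fun r hr => ?_) (hmono (φ.m - φ.n) _ _ ?_)
    · obtain ⟨k, -, rfl⟩ := φ.exists_of_coeff_head_ne hr
      exact ⟨φ.m - k, by push_cast; field_simp⟩
    · simp only [paramExp]; push_cast; field_simp; ring
  unfold along
  induction R using MvPolynomial.induction_on with
  | C c =>
    rw [MvPolynomial.aeval_C, algebraMap_eq_mono]
    exact hmono 0 0 _ (by simp)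
  | add p q hp hq => rw [map_add]; exact hadd _ _ hp hq
  | mul_X p i hp =>
    rw [map_mul, MvPolynomial.aeval_X]
    refine hmul _ _ hp ?_
    fin_cases i
    · exact hmono φ.m 1 1 (by push_cast; field_simp)
    · exact hexpr

lemma exists_leadsWith {φ : Series} {R : MvPolynomial (Fin 2) ℂ} {r : ℚ} {h : ℂ[X]}
    (H : HasLeadingTerm (φ.along R) r h) : ∃ e : ℤ, φ.LeadsWith R e h := by
  obtain ⟨e, rfl⟩ := φ.exists_int_of_coeff_along_ne R r (H.2.1 ▸ H.1)
  exact ⟨e, H⟩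

/-! ### Truncation -/

/-- For rational `t` with `t < 1`, the terms of `φ` of exponent `> t`, followed by `ξ x ^ t`,
form a series `ψ` in lowest terms. -/
lemma exists_truncation {t : ℚ} (ht : t < 1) :
    ∃ (ψ : Series) (c : ℂ), ψ.paramExp = t ∧ TopCoeff (φ.head - ψ.head) t (Polynomial.C c) := by
  classical
  -- The denominators that serve for all exponents involved; the least one gives lowest terms.
  let p : ℕ → Prop := fun M => 0 < M ∧ (∃ N : ℕ, t = 1 - (N : ℚ) / M) ∧
    ∀ r, t < r → φ.head.coeff r ≠ 0 → ∃ k : ℕ, r = 1 - (k : ℚ) / M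
  have hφm : (φ.m : ℚ) ≠ 0 := by exact_mod_cast φ.m_pos.ne'
  have hex : ∃ M, p M := by
    have hden : ((1 - t).den : ℚ) ≠ 0 := by exact_mod_cast (1 - t).den_nz
    refine ⟨φ.m * (1 - t).den, Nat.mul_pos φ.m_pos (1 - t).den_pos,
      ⟨φ.m * (1 - t).num.toNat, ?_⟩, ?_⟩
    · have hnum : (((1 - t).num.toNat : ℕ) : ℚ) = (1 - t).num := by
        have : (0 : ℤ) ≤ (1 - t).num := Rat.num_nonneg.2 (by linarith)
        exact_mod_cast Int.toNat_of_nonneg this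
      push_cast
      rw [hnum, mul_div_mul_left _ _ hφm, Rat.num_div_den]
      ring
    · intro r _ hr
      obtain ⟨k, -, rfl⟩ := φ.exists_of_coeff_head_ne hr
      refine ⟨k * (1 - t).den, ?_⟩
      push_cast
      rw [mul_div_mul_right _ _ hden]
  obtain ⟨hM, ⟨N, hN⟩, hk⟩ := Nat.find_spec hex
  have hmin : ∀ M', p M' → Nat.find hex ≤ M' := fun M' h => Nat.find_min' hex h
  generalize Nat.find hex = M at hM hN hk hmin
  have hM' : (0 : ℚ) < M := by exact_mod_cast hM
  have hN0 : 0 < N := by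
    rcases Nat.eq_zero_or_pos N with rfl | h
    · simp at hN; linarith
    · exact h
  have hlt : ∀ k : ℕ, t < 1 - (k : ℚ) / M ↔ k < N := by
    intro k
    rw [hN, sub_lt_sub_iff_left, div_lt_div_iff_of_pos_right hM', Nat.cast_lt]
  have hpos : ∀ k : ℕ, φ.head.coeff (1 - (k : ℚ) / M) ≠ 0 → 1 ≤ k := by
    intro k h
    have := φ.lt_one_of_coeff_head_ne h
    rcases Nat.eq_zero_or_pos k with rfl | h
    · simp at this
    · exact h
  let ψ : Series :=
    { m := M
      n := N
      a := fun k => (φ.head.coeff (1 - (k : ℚ) / M)).coeff 0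
      m_pos := hM
      n_pos := hN0
      lowest_terms := by
        rintro d ⟨M', rfl⟩ ⟨N', rfl⟩ hd
        have hd0 : 0 < d := Nat.pos_of_mul_pos_right hM
        have hM'0 : 0 < M' := Nat.pos_of_mul_pos_left hM
        have hdq : (d : ℚ) ≠ 0 := by exact_mod_cast hd0.ne'
        have hle := hmin M' ⟨hM'0, ⟨N', ?_⟩, ?_⟩
        · nlinarith
        · rw [hN]; push_cast; rw [mul_div_mul_left _ _ hdq]
        · intro r hr hne
          obtain ⟨k, rfl⟩ := hk r hr hne
          obtain ⟨k', rfl⟩ := hd k (Finset.mem_Ico.2 ⟨hpos k hne, (hlt k).1 hr⟩) (by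
            intro h0
            rw [coeff_head_eq_C, h0, map_zero] at hne
            exact hne rfl)
          exact ⟨k', by push_cast; rw [mul_div_mul_left _ _ hdq]⟩ }
  refine ⟨ψ, (φ.head.coeff t).coeff 0, hN.symm, ?_, fun s hs => ?_⟩
  · have h0 : ψ.head.coeff t = 0 := by
      by_contra h
      obtain ⟨k, hk, h⟩ := ψ.exists_of_coeff_head_ne h
      exact ((hlt k).2 (Finset.mem_Ico.1 hk).2).ne h
    rw [AddMonoidAlgebra.coeff_sub, Finsupp.sub_apply, h0, sub_zero, ← coeff_head_eq_C]
  · rw [AddMonoidAlgebra.coeff_sub, Finsupp.sub_apply, sub_eq_zero, ψ.coeff_head]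
    have hterm : ∀ k ∈ Finset.Ico 1 ψ.n,
        (if 1 - (k : ℚ) / ψ.m = s then Polynomial.C (ψ.a k) else 0) =
          if 1 - (k : ℚ) / M = s then φ.head.coeff s else 0 := by
      intro k _
      change (if 1 - (k : ℚ) / M = s then
        Polynomial.C ((φ.head.coeff (1 - (k : ℚ) / M)).coeff 0) else 0) = _
      split_ifs with h
      · rw [← coeff_head_eq_C, h]
      · rfl
    rw [Finset.sum_congr rfl hterm]
    by_cases h0 : φ.head.coeff s = 0
    · simp [h0]
    · obtain ⟨k, rfl⟩ := hk s hs h0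
      rw [Finset.sum_eq_single_of_mem k (Finset.mem_Ico.2 ⟨hpos k h0, (hlt k).1 hs⟩), if_pos rfl]
      intro j _ hj
      refine if_neg fun h => hj ?_
      have := (div_left_inj' hM'.ne').1 (sub_right_injective h)
      exact_mod_cast this

end Series

/-! ### The first exponent at which the order vanishes -/

/-- If all exponents of `F` are negative and some monomial `ξ ^ i x ^ r` of `F` satisfies
`r + i σ > 0`, then for some `0 < τ < σ` the substitution `ξ ↦ ξ x ^ τ` makes the order of `F` equal
to `0`. -/
lemma exists_shift_order_zero {F : FracSums} (hF : ∀ r, 0 ≤ r → F.coeff r = 0) {σ r : ℚ} {i : ℕ}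
    (hne : (F.coeff r).coeff i ≠ 0) (hpos : 0 < r + i * σ) :
    ∃ τ, 0 < τ ∧ τ < σ ∧ ∃ h, HasLeadingTerm (substParam (mono τ Polynomial.X) F) 0 h := by
  have hneg : ∀ r i, (F.coeff r).coeff i ≠ 0 → r < 0 := by
    intro r i h
    by_contra hr
    rw [hF r (not_lt.1 hr)] at h
    simp at h
  -- The monomials `(r, i)` with `i ≥ 1`: each one stays at order `≤ 0` up to `τ = -r / i`.
  let A : Finset (Σ _ : ℚ, ℕ) :=
    F.coeff.support.sigma fun r => (F.coeff r).support.filter (1 ≤ ·)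
  have hA : ∀ r i, (⟨r, i⟩ : Σ _ : ℚ, ℕ) ∈ A ↔ (F.coeff r).coeff i ≠ 0 ∧ 1 ≤ i := by
    intro r i
    simp only [A, Finset.mem_sigma, Finset.mem_filter, Finsupp.mem_support_iff,
      Polynomial.mem_support_iff]
    refine ⟨fun h => h.2, fun h => ⟨fun h0 => h.1 (by simp [h0]), h⟩⟩
  have hi : 1 ≤ i := by
    rcases Nat.eq_zero_or_pos i with rfl | h
    · have := hneg r 0 hne
      simp at hpos; linarith
    · exact h
  obtain ⟨⟨r₀, i₀⟩, h₀, hmin⟩ := A.exists_min_image (fun z => -z.1 / z.2) ⟨_, (hA r i).2 ⟨hne, hi⟩⟩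
  obtain ⟨hne₀, hi₀⟩ := (hA _ _).1 h₀
  have hcast : ∀ j : ℕ, 1 ≤ j → (0 : ℚ) < j := fun j h => by exact_mod_cast h
  refine ⟨-r₀ / i₀, div_pos (by have := hneg _ _ hne₀; linarith) (hcast _ hi₀), ?_, _,
    ?_, rfl, ?_⟩
  · refine (hmin _ ((hA r i).2 ⟨hne, hi⟩)).trans_lt ?_
    rw [div_lt_iff₀ (hcast i hi)]
    linarith
  · intro h
    have := coeff_substParam_shift (-r₀ / i₀) F 0 i₀
    rw [h, zero_sub, mul_div_cancel₀ _ (hcast _ hi₀).ne', neg_neg] at this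
    exact hne₀ (by rw [← this, Polynomial.coeff_zero])
  · intro s hs
    ext j
    rw [coeff_substParam_shift, Polynomial.coeff_zero]
    by_contra h
    rcases Nat.eq_zero_or_pos j with rfl | hj
    · have := hneg _ _ h
      simp at this; linarith
    · have := hmin _ ((hA _ _).2 ⟨h, hj⟩)
      have := (le_div_iff₀ (hcast j hj)).1 this
      linarith

/-- For `R` monic in `y`, the order of `R(x, E)` is governed by the power `y ^ deg R` as soon as `E`
has order `> 1`. -/
lemma topCoeff_aeval_of_isMonicInY {R : MvPolynomial (Fin 2) ℂ} (hR : IsMonicInY R) (hR0 : R ≠ 0)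
    {E : FracSums} {t : ℚ} {h : ℂ[X]} (ht : 1 < t) (hE : TopCoeff E t h) :
    ∃ c : ℂ, c ≠ 0 ∧ TopCoeff (MvPolynomial.aeval ![mono 1 1, E] R) (R.totalDegree * t)
      (Polynomial.C c * h ^ R.totalDegree) := by
  classical
  have hdeg : ∀ d ∈ R.support, d 0 + d 1 ≤ R.totalDegree := by
    intro d hd
    have := MvPolynomial.le_totalDegree hd
    rwa [Finsupp.sum_fintype _ _ fun _ => rfl, Fin.sum_univ_two] at this
  obtain ⟨d₀, hd₀, h1⟩ : ∃ d ∈ R.support, d 1 = R.totalDegree := by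
    obtain ⟨d, hd, h⟩ := Finset.exists_mem_eq_sup R.support
      (MvPolynomial.support_nonempty.2 hR0) (fun d => d 1)
    exact ⟨d, hd, by rw [← hR, MvPolynomial.degreeOf_eq_sup, h]⟩
  have h0 : d₀ 0 = 0 := by have := hdeg d₀ hd₀; omega
  refine ⟨R.coeff d₀, MvPolynomial.mem_support_iff.1 hd₀, ?_⟩
  rw [MvPolynomial.aeval_def, MvPolynomial.eval₂_eq']
  have hterm : ∀ d ∈ R.support, TopCoeff
      (algebraMap ℂ FracSums (R.coeff d) * ∏ i, ![mono 1 1, E] i ^ d i) (R.totalDegree * t)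
      (if d = d₀ then Polynomial.C (R.coeff d₀) * h ^ R.totalDegree else 0) := by
    intro d hd
    have hd' := (topCoeff_mono 0 (Polynomial.C (R.coeff d))).mul
      (((topCoeff_mono 1 1).pow (d 0)).mul (hE.pow (d 1)))
    rw [Fin.prod_univ_two, algebraMap_eq_mono]
    simp only [zero_add, mul_one, one_pow, one_mul] at hd'
    split_ifs with hdd
    · subst hdd
      simpa [h0, h1] using hd'
    · refine hd'.of_lt ?_
      have hle := hdeg d hd
      have hlt : d 1 < R.totalDegree := by
        refine lt_of_le_of_ne (by omega) fun h => hdd ?_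
        ext i
        fin_cases i
        · change d 0 = d₀ 0; omega
        · change d 1 = d₀ 1; omega
      have hle' : (d 0 : ℚ) + d 1 ≤ R.totalDegree := by exact_mod_cast hle
      have hlt' : (d 1 : ℚ) < R.totalDegree := by exact_mod_cast hlt
      nlinarith [mul_pos (sub_pos.2 hlt') (sub_pos.2 ht)]
  have := TopCoeff.sum hterm
  rwa [Finset.sum_ite_eq', if_pos hd₀] at this

/-! ### The Jacobian along a series -/

/-- The chain rule for `J(P, Q)`, with the Euler derivation in place of `∂/∂x`. -/
lemma Series.along_jacobian (φ : Series) (P Q : MvPolynomial (Fin 2) ℂ) :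
    φ.along (jacobian P Q) * mono (1 + φ.paramExp) 1 =
      eulerDeriv (φ.along P) * derivParam (φ.along Q) -
        derivParam (φ.along P) * eulerDeriv (φ.along Q) := by
  have hx : eulerDeriv (mono 1 1) = mono 1 1 := by rw [eulerDeriv_mono]; simp
  have hx' : derivParam (mono 1 1) = 0 := by rw [derivParam_mono]; simp [mono]
  have hE : derivParam φ.expr = mono φ.paramExp 1 := by
    rw [Series.expr, Series.subst_eq, Series.head, mono_mul_mono, map_add, map_sum, derivParam_mono]
    simp only [derivParam_mono]
    simp [mono]
  have hmul : mono (1 + φ.paramExp) 1 = mono 1 1 * mono φ.paramExp 1 := by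
    rw [mono_mul_mono, mul_one]
  simp only [Series.along, derivation_aeval, jacobian, map_sub, map_mul, Matrix.cons_val_zero,
    Matrix.cons_val_one, hx, hx', hE, hmul]
  ring

/-- If `P` has positive order and `Q` order `0` along `φ`, both with nonconstant leading
coefficient, then `φ` is singular: `j_φ` is `p_φ q_φ'` up to a nonzero factor. -/
lemma Series.isSingular_of_topCoeff {φ : Series} {P Q : MvPolynomial (Fin 2) ℂ} {α : ℚ}
    {p q : ℂ[X]} (hα : 0 < α) (hP : TopCoeff (φ.along P) α p) (hQ : TopCoeff (φ.along Q) 0 q)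
    (hp : 0 < p.natDegree) (hq : 0 < q.natDegree) : φ.IsSingular P Q := by
  have hp0 : p ≠ 0 := by rintro rfl; simp at hp
  have hq0 : Polynomial.derivative q ≠ 0 := fun h =>
    hq.ne' (Polynomial.derivative_eq_zero.1 h)
  have hαC : Polynomial.C (α : ℂ) ≠ 0 := by
    rw [Ne, Polynomial.C_eq_zero]; exact_mod_cast hα.ne'
  have h := (hP.eulerDeriv.mul hQ.derivParam).sub (hP.derivParam.mul hQ.eulerDeriv)
  rw [← φ.along_jacobian] at h
  simp only [Rat.cast_zero, map_zero, zero_mul, mul_zero, sub_zero, add_zero] at h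
  have hJ := h.mul (topCoeff_mono (-(1 + φ.paramExp)) 1)
  rw [mul_assoc, mono_mul_mono, add_neg_cancel, mul_one, mono_zero_one, mul_one, mul_one] at hJ
  obtain ⟨e, he⟩ := Series.exists_leadsWith
    (hJ.hasLeadingTerm (mul_ne_zero (mul_ne_zero hαC hp0) hq0))
  refine ⟨e, _, he, ?_⟩
  rw [Polynomial.natDegree_mul (mul_ne_zero hαC hp0) hq0, Polynomial.natDegree_C_mul
    (Polynomial.C_ne_zero.1 hαC)]
  omega

/-! ### Existence of the horizontal singular series -/

lemma natDegree_pos_of_comp_C_eq_zero {h : ℂ[X]} {c : ℂ} (h0 : h ≠ 0)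
    (hc : h.comp (Polynomial.C c) = 0) : 0 < h.natDegree := by
  by_contra hd
  rw [Polynomial.eq_C_of_natDegree_eq_zero (by omega : h.natDegree = 0), Polynomial.C_comp] at hc
  exact h0 (by rw [Polynomial.eq_C_of_natDegree_eq_zero (by omega : h.natDegree = 0), hc])

/-- If `Q`, monic in `y`, has negative order along `φ`, then for some `t` between the parameter
exponent of `φ` and `1` it has order `0` along the expression `φ(x, 0) + ξ x ^ t`. -/
lemma Series.exists_subst_order_zero {Q : MvPolynomial (Fin 2) ℂ} (hQ : IsMonicInY Q) {φ : Series}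
    {r : ℚ} {q : ℂ[X]} (hr : r < 0) (hq : HasLeadingTerm (φ.along Q) r q) :
    ∃ t, φ.paramExp < t ∧ t < 1 ∧ ∃ h, HasLeadingTerm
      (substParam (mono (t - φ.paramExp) Polynomial.X) (φ.along Q)) 0 h := by
  have hQ0 : Q ≠ 0 := by
    rintro rfl
    exact hq.1 (by rw [← hq.2.1]; simp [Series.along])
  have hneg : ∀ s, 0 ≤ s → (φ.along Q).coeff s = 0 := fun s hs => hq.2.2 s (hr.trans_le hs)
  -- Any exponent above `1` in place of `2` shows that `ξ ^ N` occurs, where `N = deg Q`.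
  have hE : TopCoeff (φ.subst (mono (2 - φ.paramExp) Polynomial.X)) 2 Polynomial.X := by
    rw [Series.subst_eq, mono_mul_mono, mul_one, sub_add_cancel]
    simpa using (φ.topCoeff_head one_le_two).add (topCoeff_mono 2 Polynomial.X)
  obtain ⟨c, hc, htop⟩ := topCoeff_aeval_of_isMonicInY hQ hQ0 one_lt_two hE
  rw [← Series.substParam_along] at htop
  have hcoeff := coeff_substParam_shift (2 - φ.paramExp) (φ.along Q) (Q.totalDegree * 2)
    Q.totalDegree
  rw [htop.1, Polynomial.coeff_C_mul, Polynomial.coeff_X_pow_self, mul_one,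
    show (Q.totalDegree : ℚ) * 2 - Q.totalDegree * (2 - φ.paramExp) =
      Q.totalDegree * φ.paramExp by ring] at hcoeff
  have hne : ((φ.along Q).coeff (Q.totalDegree * φ.paramExp)).coeff Q.totalDegree ≠ 0 :=
    hcoeff ▸ hc
  have hN : (0 : ℚ) < Q.totalDegree := by
    rcases Nat.eq_zero_or_pos Q.totalDegree with h | h
    · rw [h, hneg _ (by simp)] at hne
      simp at hne
    · exact_mod_cast h
  obtain ⟨τ, hτ, hτ', h, hh⟩ := exists_shift_order_zero hneg (σ := 1 - φ.paramExp) hne (by linarith)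
  exact ⟨τ + φ.paramExp, by linarith, by linarith, h, by rwa [add_sub_cancel_right]⟩

/-- If `P` has order `0` with nonconstant leading coefficient along `φ` and `Q` has negative order,
then a truncation `ψ` of `φ` is horizontal for `Q` and singular: at the exponent where `Q` has order
`0`, the order of `P` is still positive. -/
lemma Series.exists_horizontal_singular {P Q : MvPolynomial (Fin 2) ℂ} (hQ : IsMonicInY Q)
    {φ : Series} {r : ℚ} {p q : ℂ[X]} (hr : r < 0) (hp : HasLeadingTerm (φ.along P) 0 p)
    (hq : HasLeadingTerm (φ.along Q) r q) (hdeg : 0 < p.natDegree) :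
    ∃ ψ : Series, ψ.IsHorizontal Q ∧ ψ.IsSingular P Q ∧ ψ.Prec φ := by
  obtain ⟨t, ht, ht1, h, hh⟩ := Series.exists_subst_order_zero hQ hr hq
  obtain ⟨ψ, c, hψ, htop⟩ := φ.exists_truncation ht1
  have hmulC : TopCoeff ((φ.head - ψ.head) * mono (-t) 1) 0 (Polynomial.C c) := by
    simpa using htop.mul (topCoeff_mono (-t) 1)
  generalize hD : (φ.head - ψ.head) * mono (-t) 1 = D at hmulC
  have hhead : φ.head = ψ.head + D * mono t 1 := by
    rw [← hD, mul_assoc, mono_mul_mono, neg_add_cancel, mul_one, mono_zero_one, mul_one,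
      add_sub_cancel]
  -- `φ` is obtained from `ψ` by the substitution `ξ ↦ c + lower terms`.
  let u : FracSums := D + mono (φ.paramExp - t) Polynomial.X
  have hu : TopCoeff u 0 (Polynomial.C c) := by
    simpa using hmulC.add ((topCoeff_mono (φ.paramExp - t) Polynomial.X).of_lt (s := 0)
      (by linarith))
  have hφψ : φ.expr = ψ.subst u := by
    rw [Series.expr, Series.subst_eq, Series.subst_eq, hψ, hhead, add_mul, mono_mul_mono,
      mono_mul_mono, sub_add_cancel, zero_add, add_assoc]
  have halong : ∀ R, φ.along R = substParam u (ψ.along R) := by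
    intro R
    rw [Series.substParam_along, ← hφψ, Series.along]
  -- Conversely `ψ` is `φ(x, 0) + ξ x ^ t` up to a translation of `ξ` and lower terms.
  have hw : TopCoeff (mono 0 Polynomial.X - D) 0 (Polynomial.X - Polynomial.C c) :=
    (topCoeff_mono 0 Polynomial.X).sub hmulC
  have hψQ : ψ.along Q = substParam (mono 0 Polynomial.X - D)
      (substParam (mono (t - φ.paramExp) Polynomial.X) (φ.along Q)) := by
    rw [Series.substParam_along, substParam_aeval, Series.along]
    congr 4
    rw [Series.expr, Series.subst_eq, Series.subst_eq, mono_mul_mono, mono_mul_mono, hψ,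
      sub_add_cancel, zero_add, mul_one, map_add, Series.substParam_head, substParam_mono,
      Polynomial.aeval_X, hhead, sub_mul, mono_mul_mono, zero_add, mul_one]
    ring
  have hQtop : TopCoeff (ψ.along Q) 0 (h.comp (Polynomial.X - Polynomial.C c)) :=
    hψQ ▸ hh.topCoeff.substParam hw
  have hq0 : h.comp (Polynomial.X - Polynomial.C c) ≠ 0 := by
    intro h0
    rw [sub_eq_add_neg, ← map_neg, Polynomial.comp_X_add_C_eq_zero_iff] at h0
    exact hh.1 h0
  generalize h.comp (Polynomial.X - Polynomial.C c) = q₁ at hQtop hq0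
  -- The order of `Q` drops from `ψ` to `φ`, so `c` is a root of the leading coefficient of `Q`.
  have hqdeg : 0 < q₁.natDegree := by
    refine natDegree_pos_of_comp_C_eq_zero (c := c) hq0 ?_
    have := hQtop.substParam hu
    rw [← halong] at this
    rw [← this.1, hq.2.2 0 hr]
  -- The order of `P` drops as well: otherwise `p` would be a constant.
  have hP0 : ψ.along P ≠ 0 := by
    intro h0
    have := halong P
    rw [h0, map_zero] at this
    exact hp.1 (by rw [← hp.2.1, this]; simp)
  obtain ⟨α, p₁, hp₁⟩ := exists_hasLeadingTerm hP0
  have hPφ := hp₁.topCoeff.substParam hu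
  rw [← halong] at hPφ
  have hα : 0 < α := by
    refine lt_of_le_of_ne (hPφ.le_of_coeff_ne (hp.2.1 ▸ hp.1)) ?_
    rintro rfl
    rw [hp.topCoeff.unique_coeff hPφ, Polynomial.comp_C] at hdeg
    simp at hdeg
  have hpdeg : 0 < p₁.natDegree := by
    refine natDegree_pos_of_comp_C_eq_zero (c := c) hp₁.1 ?_
    rw [← hPφ.1, hp.2.2 α hα]
  refine ⟨ψ, ⟨q₁, ?_, hqdeg⟩, Series.isSingular_of_topCoeff hα hp₁.topCoeff hQtop hpdeg hqdeg, c,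
    u - mono 0 (Polynomial.C c), fun s hs => ?_, by rw [add_sub_cancel, hφψ]⟩
  · simpa [Series.LeadsWith] using hQtop.hasLeadingTerm hq0
  · rw [AddMonoidAlgebra.coeff_sub, Finsupp.sub_apply, coeff_mono]
    rcases hs.eq_or_lt with rfl | hs
    · rw [hu.1, if_pos rfl, sub_self]
    · rw [hu.2 s hs, if_neg hs.ne, sub_self]

end NewtonPuiseux

end

theorem theorem2 (P Q : MvPolynomial (Fin 2) ℂ)
    (hP : NewtonPuiseux.IsMonicInY P) (hQ : NewtonPuiseux.IsMonicInY Q)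
    (φ : NewtonPuiseux.Series) (hφ : φ.IsDicritical P Q)
    (a b : ℤ) (p q : Polynomial ℂ)
    (hp : φ.LeadsWith P a p) (hq : φ.LeadsWith Q b q)
    (ha : a = 0) (hb : b < 0) :
    φ.IsSingular P Q ∨
      ∃ ψ : NewtonPuiseux.Series, ψ.IsHorizontal Q ∧ ψ.IsSingular P Q ∧ ψ.Prec φ := by
  -- The second alternative holds even when `φ` itself is singular.
  right
  have hm : (0 : ℚ) < φ.m := by exact_mod_cast φ.m_pos
  have hr : (b : ℚ) / φ.m < 0 := div_neg_of_neg_of_pos (by exact_mod_cast hb) hm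
  subst ha
  have hp' : NewtonPuiseux.HasLeadingTerm (φ.along P) 0 p := by
    simpa [NewtonPuiseux.Series.LeadsWith] using hp
  refine NewtonPuiseux.Series.exists_horizontal_singular hQ hr hp' hq ?_
  obtain ⟨⟨h, hh, hdeg⟩ | ⟨h, hh, -⟩, -⟩ := hφ
  · rwa [← hh.2.1.symm.trans hp.2.1]
  · -- `Q` has negative order along `φ`, so `φ` is not horizontal for `Q`.
    refine absurd (hh.2.1.symm.trans (hq.2.2 _ ?_)) hh.1
    simpa using hr
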